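/- **Setting.** An output port transmits frames of several classes on a link of constant rate $C>0$. It uses non-preemptive static priority: one frame is transmitted at a time, at rate $C$ and without interruption; each class has a FIFO queue; the link is never idle while a frame waits; a transmission that starts is that of a frame of a class whose current priority is the highest among those of the waiting frames (a smaller number is a higher priority). Each class $j$ has a maximum frame size $MFS_j>0$ and priority levels $p_H(j)\le p_L(j)$. If $p_H(j)<p_L(j)$, class $j$ is shaped by a burst limiting shaper (BLS) with parameters $0\le L_R^j<L_M^j$, $0<BW^j<1$, $I_{idle}^j=BW^j\cdot C$ and $I_{send}^j=C-I_{idle}^j$: a credit counter starts at $0$, increases at rate $I_{send}^j$ while a frame of class $j$ is transmitted (staying at $L_M^j$ once it is there), and decreases at rate $I_{idle}^j$ otherwise (staying at $0$ once it is there). The current priority $p(j)$ is initially $p_H(j)$, becomes $p_L(j)$ when the credit reaches $L_M^j$, and becomes $p_H(j)$ again when the credit comes back to $L_R^j$. If $p_H(j)=p_L(j)$, then $p(j)$ is constant. The port starts empty at time $0$ and finitely many frames arrive in bounded time. $R_j(t)$ and $R_j^*(t)$ are the numbers of bits of class $j$ received and transmitted until time $t$. Let $k$ be a class shaped by a BLS,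 and let $MC(k)$ be the classes $j$ whose current priority satisfies $p_H(k)<p(j)<p_L(k)$. At time $\tau$, $MC(k)$ is backlogged if $R_j(\tau)-R_j^*(\tau)>0$ for some class $j$ that is in $MC(k)$ at time $\tau$. A curve $\gamma$ is a maximum service curve for class $k$ during periods of some kind if $R_k^*(t)\le\inf_{s\le u\le t}\left(R_k(u)+\gamma(t-u)\right)$ for every period $]s,t]$ of this kind, $0\le s\le t$. **Theorem** (maximum service curve offered to a BLS class $k$ by a BLS node). During periods at no time of which $MC(k)$ is backlogged, $\gamma_k^{bls}(t)=C\cdot t$ is a maximum service curve for class $k$. During periods at all times of which $MC(k)$ is backlogged, $$\gamma_k^{bls}(t)=\frac{\Delta_{send}^{k,\gamma}}{\Delta_{inter}^{k,\gamma}}\cdot C\cdot t+b_k^{max}\cdot\frac{\Delta_{idle}^{k,\gamma}}{\Delta_{inter}^{k,\gamma}}$$ is a maximum service curve for class $k$, where $$b_k^{max}=\frac{C}{I_{send}^k}\cdot L_M^k+MFS_k,\qquad \Delta_{send}^{k,\gamma}=\frac{MFS_k}{C}+\frac{L_M^k-L_R^k}{I_{send}^k},\qquad \Delta_{idle}^{k,\gamma}=\frac{L_M^k-L_R^k}{I_{idle}^k},\qquad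 \Delta_{inter}^{k,\gamma}=\Delta_{send}^{k,\gamma}+\Delta_{idle}^{k,\gamma}.$$ In both cases the output itself is bounded by the curve: $R_k^*(t)-R_k^*(s)\le\gamma_k^{bls}(t-s)$ for every such period $]s,t]$. -/

import Mathlib

open Set

noncomputable section

/-- Static parameters of an output port of rate `C` whose queues, one per class in `ι`, are served by
a non-preemptive static-priority scheduler on top of which burst limiting shapers (BLS) are
implemented. Smaller numbers are higher priorities. A class `j` is shaped iff `pH j < pL j`;
otherwise its priority is constant and its BLS parameters play no role. -/
structure BLSServer (ι : Type*) where
  /-- link rate -/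
  C : ℝ
  /-- high priority level -/
  pH : ι → ℕ
  /-- low priority level -/
  pL : ι → ℕ
  /-- maximum credit level -/
  LM : ι → ℝ
  /-- resume credit level -/
  LR : ι → ℝ
  /-- reserved fraction of the bandwidth -/
  BW : ι → ℝ
  /-- maximum frame size -/
  MFS : ι → ℝ
  C_pos : 0 < C
  pH_le_pL : ∀ j, pH j ≤ pL j
  LR_nonneg : ∀ j, pH j < pL j → 0 ≤ LR j
  LR_lt_LM : ∀ j, pH j < pL j → LR j < LM j
  BW_pos : ∀ j, pH j < pL j → 0 < BW j
  BW_lt_one : ∀ j, pH j < pL j → BW j < 1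
  MFS_pos : ∀ j, 0 < MFS j

namespace BLSServer

variable {ι : Type*} (S : BLSServer ι)

/-- Class `j` is shaped by a BLS. -/
def Shaped (j : ι) : Prop := S.pH j < S.pL j

/-- Idle slope: the rate at which credit is gained (the counter decreases). -/
def Iidle (j : ι) : ℝ := S.BW j * S.C

/-- Sending slope: the rate at which credit is consumed (the counter increases). -/
def Isend (j : ι) : ℝ := S.C - S.Iidle j

def deltaSend (k : ι) : ℝ := S.MFS k / S.C + (S.LM k - S.LR k) / S.Isend k

def deltaIdle (k : ι) : ℝ := (S.LM k - S.LR k) / S.Iidle k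

def deltaInter (k : ι) : ℝ := S.deltaSend k + S.deltaIdle k

def bMax (k : ι) : ℝ := S.C / S.Isend k * S.LM k + S.MFS k

end BLSServer

/-- The frames crossing a port (indexed by `Φ`) and the times at which their transmissions start. -/
structure FrameSchedule (ι Φ : Type*) where
  /-- class of a frame -/
  cls : Φ → ι
  /-- arrival time of a frame in its queue -/
  arr : Φ → ℝ
  /-- size of a frame -/
  size : Φ → ℝ
  /-- the frames that are transmitted at some time (a frame can be starved for ever) -/
  sent : Set Φ
  /-- start of the transmission of a frame; meaningful for frames in `sent` only -/
  start : Φ → ℝ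

namespace FrameSchedule

variable {ι Φ : Type*} (X : FrameSchedule ι Φ)

/-- Frame `f` occupies the link of rate `C` at time `t`. -/
def InTransmission (C : ℝ) (f : Φ) (t : ℝ) : Prop :=
  f ∈ X.sent ∧ X.start f ≤ t ∧ t < X.start f + X.size f / C

/-- Some frame of class `j` is being transmitted at time `t`. -/
def Transmitting (C : ℝ) (j : ι) (t : ℝ) : Prop :=
  ∃ f, X.cls f = j ∧ X.InTransmission C f t

/-- Frame `g` has arrived by time `t` and its transmission has not started by time `t`. -/
def Waiting (g : Φ) (t : ℝ) : Prop :=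
  X.arr g ≤ t ∧ ¬ (g ∈ X.sent ∧ X.start g ≤ t)

/-- Input cumulative function of class `j`: number of bits received until time `t`. -/
def input (j : ι) (t : ℝ) : ℝ :=
  ∑ᶠ f ∈ {f | X.cls f = j ∧ X.arr f ≤ t}, X.size f

/-- Output cumulative function of class `j`: number of bits transmitted until time `t`. -/
def output (C : ℝ) (j : ι) (t : ℝ) : ℝ :=
  ∑ᶠ f ∈ {f | X.cls f = j ∧ f ∈ X.sent ∧ X.start f ≤ t}, min (X.size f) (C * (t - X.start f))

end FrameSchedule

section Dynamics

variable {ι Φ : Type*} (S : BLSServer ι) (X : FrameSchedule ι Φ)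

/-- `c` is the credit counter of class `j`: it starts at `0`; while a frame of class `j` is being
transmitted it increases at rate `Isend`, being held at `LM` once it is there; otherwise it
decreases at rate `Iidle`, being held at `0` once it is there. -/
structure IsCredit (j : ι) (c : ℝ → ℝ) : Prop where
  zero : c 0 = 0
  sending : ∀ a b : ℝ, 0 ≤ a → a ≤ b → (∀ τ ∈ Ico a b, X.Transmitting S.C j τ) →
    c b = min (S.LM j) (c a + S.Isend j * (b - a))
  idle : ∀ a b : ℝ, 0 ≤ a → a ≤ b → (∀ τ ∈ Ico a b, ¬ X.Transmitting S.C j τ) →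
    c b = max 0 (c a - S.Iidle j * (b - a))

/-- The queue of class `j` with credit counter `c` has its low priority at time `t`: the credit has
reached `LM` and has not come back to `LR` since. (Initially the priority is high.) -/
def IsLow (j : ι) (c : ℝ → ℝ) (t : ℝ) : Prop :=
  ∃ u, 0 ≤ u ∧ u ≤ t ∧ c u = S.LM j ∧ ∀ v ∈ Icc u t, S.LR j < c v

open Classical in
/-- The priority level of class `j` at time `t`. -/
def prio (credit : ι → ℝ → ℝ) (j : ι) (t : ℝ) : ℕ :=
  if IsLow S j (credit j) t then S.pL j else S.pH j

/-- `X` is a behaviour of the server `S`, from time `0` on with empty queues, and `credit` are the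
credit counters of its shaped classes. -/
structure IsBLSRun (credit : ι → ℝ → ℝ) : Prop where
  arr_nonneg : ∀ f, 0 ≤ X.arr f
  size_pos : ∀ f, 0 < X.size f
  size_le : ∀ f, X.size f ≤ S.MFS (X.cls f)
  locally_finite : ∀ t : ℝ, {f | X.arr f ≤ t}.Finite
  /-- a frame is only sent once it has arrived -/
  causal : ∀ f ∈ X.sent, X.arr f ≤ X.start f
  /-- transmissions are at rate `C`, uninterrupted, and one at a time -/
  exclusive : ∀ f ∈ X.sent, ∀ g ∈ X.sent, f ≠ g →
    X.start f + X.size f / S.C ≤ X.start g ∨ X.start g + X.size g / S.C ≤ X.start f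
  /-- each queue is FIFO -/
  fifo : ∀ f g, X.cls f = X.cls g → X.arr f < X.arr g → g ∈ X.sent →
    f ∈ X.sent ∧ X.start f < X.start g
  /-- the link is never idle while a frame is waiting -/
  work_conserving : ∀ t : ℝ, (∃ g, X.Waiting g t) → ∃ f, X.InTransmission S.C f t
  /-- when a transmission starts, no waiting frame has a strictly higher priority -/
  priority : ∀ f ∈ X.sent, ∀ g, X.Waiting g (X.start f) →
    prio S credit (X.cls f) (X.start f) ≤ prio S credit (X.cls g) (X.start f)
  isCredit : ∀ j, S.Shaped j → IsCredit S X j (credit j)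

/-- At time `t` some traffic of `MC k` is backlogged, `MC k` being the classes whose priority (at
time `t`, as the priority of a shaped class varies) is strictly between `pH k` and `pL k`. -/
def MCBacklogged (credit : ι → ℝ → ℝ) (k : ι) (t : ℝ) : Prop :=
  ∃ j, S.pH k < prio S credit j t ∧ prio S credit j t < S.pL k ∧
    0 < X.input j t - X.output S.C j t

end Dynamics

/-- `γ` is a maximum service curve, for the input `R` and the output `Rout`, during the periods
`]s, t]` at all times of which `P` holds: `Rout t ≤ R s + γ (t - s)`. As a part of such a period is
such a period, this is `Rout t ≤ inf_{s ≤ u ≤ t} (R u + γ (t - u))`, and for `P` always true it is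
the usual `Rout ≤ R ⊗ γ`. -/
def IsMaxServiceCurveDuring (P : ℝ → Prop) (R Rout γ : ℝ → ℝ) : Prop :=
  ∀ s t : ℝ, 0 ≤ s → s ≤ t → (∀ τ ∈ Ioc s t, P τ) → Rout t ≤ R s + γ (t - s)

/-- The output during a period `]s, t]` at all times of which `P` holds is at most `γ (t - s)`. -/
def BoundsOutputDuring (P : ℝ → Prop) (Rout γ : ℝ → ℝ) : Prop :=
  ∀ s t : ℝ, 0 ≤ s → s ≤ t → (∀ τ ∈ Ioc s t, P τ) → Rout t - Rout s ≤ γ (t - s)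

end

/-! Weigh transmission against idleness: let `V` grow at rate 1 while class `k` transmits and fall
at rate `r = Δsend / Δidle` otherwise. The affine bound amounts to `V t - V s ≤ LM / Isend + MFS /
C`.

While the priority is high, `V t - V s` stays below credit divided by `Isend`: both grow at rate 1
during a transmission, and `r ≥ Iidle / Isend` when idle. Once the credit saturates, the priority is
low and the running frame can overshoot by at most `MFS / C`. With `MC k` backlogged, no further
frame of `k` starts until the credit is back at `LR` (`not_isLow_start`). The excess of `r` over
`Iidle / Isend` is exactly what repays one frame during that descent. `compensated_output_le` proves
this invariant by `transmission_induction`. Without backlog, only the link rate is used. -/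

namespace FrameSchedule

variable {ι Φ : Type*} (X : FrameSchedule ι Φ)

/-- Number of bits of the frame `f` transmitted until time `t`, if `f` is sent. -/
noncomputable def portion (C : ℝ) (f : Φ) (t : ℝ) : ℝ :=
  max 0 (min (X.size f) (C * (t - X.start f)))

theorem portion_of_le_start {C : ℝ} (hC : 0 < C) {f : Φ} {t : ℝ} (ht : t ≤ X.start f) :
    X.portion C f t = 0 :=
  max_eq_left ((min_le_right _ _).trans
    (mul_nonpos_of_nonneg_of_nonpos hC.le (sub_nonpos.2 ht)))

theorem portion_of_end_le {C : ℝ} (hC : 0 < C) {f : Φ} (hf : 0 < X.size f) {t : ℝ}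
    (ht : X.start f + X.size f / C ≤ t) : X.portion C f t = X.size f := by
  have h : X.size f ≤ C * (t - X.start f) := by
    rw [mul_comm, ← div_le_iff₀ hC]; linarith
  rw [portion, min_eq_left h, max_eq_right hf.le]

theorem portion_of_mem_Icc {C : ℝ} (hC : 0 < C) {f : Φ} {t : ℝ}
    (ht : t ∈ Icc (X.start f) (X.start f + X.size f / C)) :
    X.portion C f t = C * (t - X.start f) := by
  have h : C * (t - X.start f) ≤ X.size f := by
    rw [mul_comm, ← le_div_iff₀ hC]; linarith [ht.2]
  rw [portion, min_eq_right h, max_eq_right (mul_nonneg hC.le (sub_nonneg.2 ht.1))]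

end FrameSchedule

/-! ### Output accounting, scheduling and induction along transmissions -/

namespace IsBLSRun

variable {ι Φ : Type*} {S : BLSServer ι} {X : FrameSchedule ι Φ} {credit : ι → ℝ → ℝ}

theorem finite_started (hrun : IsBLSRun S X credit) (j : ι) (t : ℝ) :
    {f | X.cls f = j ∧ f ∈ X.sent ∧ X.start f ≤ t}.Finite :=
  (hrun.locally_finite t).subset fun f hf => (hrun.causal f hf.2.1).trans hf.2.2

theorem finite_arrived (hrun : IsBLSRun S X credit) (j : ι) (t : ℝ) :
    {f | X.cls f = j ∧ X.arr f ≤ t}.Finite :=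
  (hrun.locally_finite t).subset fun _ hf => hf.2

theorem lt_end (hrun : IsBLSRun S X credit) (f : Φ) :
    X.start f < X.start f + X.size f / S.C :=
  lt_add_of_pos_right _ (div_pos (hrun.size_pos f) S.C_pos)

/-- A frame contributes 0 before its start, so outputs at different times become sums over one index
set and compare term by term. -/
theorem output_eq_sum_portion (hrun : IsBLSRun S X credit) (j : ι) {t T : ℝ} (htT : t ≤ T) :
    X.output S.C j t = ∑ f ∈ (hrun.finite_started j T).toFinset, X.portion S.C f t := by
  rw [FrameSchedule.output, finsum_mem_eq_finite_toFinset_sum _ (hrun.finite_started j t)]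
  refine (Finset.sum_congr (g := fun f => X.portion S.C f t) rfl fun f hf => ?_).trans
    (Finset.sum_subset (fun f hf => ?_) fun f hf hf' => ?_)
  · simp only [Finite.mem_toFinset, mem_ofPred_eq] at hf
    exact (max_eq_right (le_min (hrun.size_pos f).le
      (mul_nonneg S.C_pos.le (sub_nonneg.2 hf.2.2)))).symm
  · simp only [Finite.mem_toFinset, mem_ofPred_eq] at hf ⊢
    exact ⟨hf.1, hf.2.1, hf.2.2.trans htT⟩
  · simp only [Finite.mem_toFinset, mem_ofPred_eq] at hf hf'
    exact X.portion_of_le_start S.C_pos (le_of_not_ge fun h => hf' ⟨hf.1, hf.2.1, h⟩)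

theorem output_eq_of_idle (hrun : IsBLSRun S X credit) {j : ι} {a b : ℝ} (hab : a ≤ b)
    (h : ∀ τ ∈ Ico a b, ¬ X.Transmitting S.C j τ) :
    X.output S.C j b = X.output S.C j a := by
  rw [hrun.output_eq_sum_portion j le_rfl, hrun.output_eq_sum_portion j hab]
  refine Finset.sum_congr rfl fun f hf => ?_
  simp only [Finite.mem_toFinset, mem_ofPred_eq] at hf
  rcases le_or_gt b (X.start f) with hb | hb
  · rw [X.portion_of_le_start S.C_pos hb, X.portion_of_le_start S.C_pos (hab.trans hb)]
  rcases le_or_gt (X.start f + X.size f / S.C) a with ha | ha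
  · rw [X.portion_of_end_le S.C_pos (hrun.size_pos f) ha,
      X.portion_of_end_le S.C_pos (hrun.size_pos f) (ha.trans hab)]
  rcases hab.eq_or_lt with rfl | hlt
  · rfl
  exact absurd ⟨f, hf.1, hf.2.1, le_max_right _ _, max_lt ha (hrun.lt_end f)⟩
    (h (max a (X.start f)) ⟨le_max_left _ _, max_lt hlt hb⟩)

theorem output_of_sending (hrun : IsBLSRun S X credit) {f : Φ} (hf : f ∈ X.sent) {a b : ℝ}
    (hab : a ≤ b) (ha : X.start f ≤ a) (hb : b ≤ X.start f + X.size f / S.C) :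
    X.output S.C (X.cls f) b = X.output S.C (X.cls f) a + S.C * (b - a) := by
  rw [hrun.output_eq_sum_portion _ le_rfl, hrun.output_eq_sum_portion _ hab]
  have hmem : f ∈ (hrun.finite_started (X.cls f) b).toFinset := by
    simpa using ⟨hf, ha.trans hab⟩
  classical
  rw [← Finset.add_sum_erase _ _ hmem, ← Finset.add_sum_erase _ _ hmem,
    X.portion_of_mem_Icc S.C_pos ⟨ha.trans hab, hb⟩,
    X.portion_of_mem_Icc S.C_pos ⟨ha, hab.trans hb⟩]
  have : ∀ g ∈ (hrun.finite_started (X.cls f) b).toFinset.erase f,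
      X.portion S.C g b = X.portion S.C g a := by
    intro g hg
    simp only [Finset.mem_erase, Finite.mem_toFinset, mem_ofPred_eq] at hg
    rcases hrun.exclusive f hf g hg.2.2.1 hg.1.symm with h | h
    · rw [X.portion_of_le_start S.C_pos (hb.trans h),
        X.portion_of_le_start S.C_pos ((hab.trans hb).trans h)]
    · rw [X.portion_of_end_le S.C_pos (hrun.size_pos g) (h.trans ha),
        X.portion_of_end_le S.C_pos (hrun.size_pos g) ((h.trans ha).trans hab)]
  rw [Finset.sum_congr rfl this]
  ring

theorem output_le_input (hrun : IsBLSRun S X credit) (j : ι) (t : ℝ) :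
    X.output S.C j t ≤ X.input j t := by
  rw [FrameSchedule.output, FrameSchedule.input,
    finsum_mem_eq_finite_toFinset_sum _ (hrun.finite_started j t),
    finsum_mem_eq_finite_toFinset_sum _ (hrun.finite_arrived j t)]
  refine (Finset.sum_le_sum fun f _ => min_le_left _ _).trans
    (Finset.sum_le_sum_of_subset_of_nonneg ?_ fun f _ _ => (hrun.size_pos f).le)
  intro f hf
  simp only [Finite.mem_toFinset, mem_ofPred_eq] at hf ⊢
  exact ⟨hf.1, (hrun.causal f hf.2.1).trans hf.2.2⟩

/-- A class that is backlogged has a frame whose transmission is not over. -/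
theorem exists_unfinished (hrun : IsBLSRun S X credit) {j : ι} {t : ℝ}
    (h : 0 < X.input j t - X.output S.C j t) :
    ∃ g, X.cls g = j ∧ X.arr g ≤ t ∧ ¬ (g ∈ X.sent ∧ X.start g + X.size g / S.C ≤ t) := by
  by_contra! hcon
  refine (sub_pos.1 h).ne ?_
  have hset : {f | X.cls f = j ∧ f ∈ X.sent ∧ X.start f ≤ t} =
      {f | X.cls f = j ∧ X.arr f ≤ t} := by
    ext f
    refine ⟨fun hf => ⟨hf.1, (hrun.causal f hf.2.1).trans hf.2.2⟩, fun hf => ?_⟩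
    have := hcon f hf.1 hf.2
    exact ⟨hf.1, this.1, (hrun.lt_end f).le.trans this.2⟩
  rw [FrameSchedule.output, FrameSchedule.input, hset]
  refine finsum_mem_congr rfl fun f hf => min_eq_left ?_
  have := (hcon f hf.1 hf.2).2
  rw [mul_comm, ← div_le_iff₀ S.C_pos]
  linarith

/-- An unfinished frame of `MC k` would be waiting at that instant, with a priority strictly better
than `pL k`. -/
theorem not_isLow_start (hrun : IsBLSRun S X credit) {f : Φ} (hf : f ∈ X.sent)
    (hMC : MCBacklogged S X credit (X.cls f) (X.start f)) :
    ¬ IsLow S (X.cls f) (credit (X.cls f)) (X.start f) := by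
  intro hlow
  obtain ⟨j, hH, hL, hback⟩ := hMC
  obtain ⟨g, rfl, harr, hg⟩ := hrun.exists_unfinished hback
  have hprio : prio S credit (X.cls f) (X.start f) = S.pL (X.cls f) := if_pos hlow
  have hfg : f ≠ g := by
    rintro rfl
    exact hL.ne hprio
  -- Had `g` started already, exclusivity would force it to be finished when `f` starts.
  have hwait : X.Waiting g (X.start f) := by
    refine ⟨harr, fun ⟨hs, hle⟩ => ?_⟩
    rcases hrun.exclusive f hf g hs hfg with h | h
    · linarith [hrun.lt_end f]
    · exact hg ⟨hs, h⟩
  have := hrun.priority f hf g hwait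
  omega

/-- Induction along the transmissions of class `k` from time `s` on: either the class has not been
transmitting since `s`, or one follows the last transmission, from its start or from `s`. -/
theorem transmission_induction (hrun : IsBLSRun S X credit) (k : ι) (s : ℝ) (P : ℝ → Prop)
    (hidle : ∀ t, s ≤ t → (∀ τ ∈ Ico s t, ¬ X.Transmitting S.C k τ) → P t)
    (hstep : ∀ t, ∀ f ∈ X.sent, X.cls f = k → ∀ p, s ≤ p → p ≤ t → X.start f ≤ p →
      p ≤ X.start f + X.size f / S.C → (p = s ∨ s < p ∧ p = X.start f) →
      (∀ τ ∈ Ico (X.start f + X.size f / S.C) t, ¬ X.Transmitting S.C k τ) → P p → P t)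
    (t : ℝ) (hst : s ≤ t) : P t := by
  have hfin : ∀ t, {f | X.cls f = k ∧ f ∈ X.sent ∧ X.start f < t}.Finite := fun t =>
    (hrun.finite_started k t).subset fun f hf => ⟨hf.1, hf.2.1, hf.2.2.le⟩
  induction hn : {f | X.cls f = k ∧ f ∈ X.sent ∧ X.start f < t}.ncard using
    Nat.strong_induction_on generalizing t with
  | _ n ih =>
  subst hn
  let A := {f | (X.cls f = k ∧ f ∈ X.sent ∧ X.start f < t) ∧ s < X.start f + X.size f / S.C}
  have hA : A.Finite := (hfin t).subset fun f hf => hf.1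
  rcases A.eq_empty_or_nonempty with hemp | hne
  · refine hidle t hst fun τ hτ ⟨f, hfk, hfs, h1, h2⟩ => ?_
    have : f ∈ A := ⟨⟨hfk, hfs, h1.trans_lt hτ.2⟩, hτ.1.trans_lt h2⟩
    simp [hemp] at this
  obtain ⟨f, ⟨⟨hfk, hfs, hft⟩, hfe⟩, hmax⟩ := exists_max_image A X.start hA hne
  have hafter : ∀ τ ∈ Ico (X.start f + X.size f / S.C) t, ¬ X.Transmitting S.C k τ := by
    rintro τ hτ ⟨g, hgk, hgs, h1, h2⟩
    have hle := hmax g ⟨⟨hgk, hgs, h1.trans_lt hτ.2⟩, (hfe.trans_le hτ.1).trans h2⟩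
    have hfg : f ≠ g := by
      rintro rfl
      exact h2.not_ge hτ.1
    rcases hrun.exclusive f hfs g hgs hfg with h | h
    · linarith [hrun.lt_end f]
    · linarith [hrun.lt_end f, hτ.1]
  rcases le_or_gt (X.start f) s with hle | hlt
  · exact hstep t f hfs hfk s le_rfl hst hle hfe.le (Or.inl rfl) hafter
      (hidle s le_rfl fun τ hτ => absurd (hτ.1.trans_lt hτ.2) (lt_irrefl _))
  · refine hstep t f hfs hfk _ hlt.le hft.le le_rfl (hrun.lt_end f).le (Or.inr ⟨hlt, rfl⟩) hafter
      (ih _ ?_ _ hlt.le rfl)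
    -- The count drops because the strict inequality excludes `f` at its own start.
    refine ncard_lt_ncard ((ssubset_iff_of_subset ?_).2 ?_) (hfin t)
    · exact fun g hg => ⟨hg.1, hg.2.1, hg.2.2.trans hft⟩
    · exact ⟨f, ⟨hfk, hfs, hft⟩, fun h => lt_irrefl _ h.2.2⟩

theorem output_sub_le (hrun : IsBLSRun S X credit) (k : ι) {s t : ℝ} (hst : s ≤ t) :
    X.output S.C k t - X.output S.C k s ≤ S.C * (t - s) := by
  have hC := S.C_pos
  refine hrun.transmission_induction k s
    (fun t => X.output S.C k t - X.output S.C k s ≤ S.C * (t - s)) ?_ ?_ t hst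
  · intro t ht h
    rw [hrun.output_eq_of_idle ht h, sub_self]
    exact mul_nonneg hC.le (sub_nonneg.2 ht)
  · rintro t f hf rfl p hsp hpt hfp hpe - hafter hP
    rcases le_total t (X.start f + X.size f / S.C) with hte | het
    · rw [hrun.output_of_sending hf hpt hfp hte]
      linarith
    · rw [hrun.output_eq_of_idle het hafter, hrun.output_of_sending hf hpe hfp le_rfl]
      have := mul_le_mul_of_nonneg_left het hC.le
      linarith

end IsBLSRun

/-! ### Credit and compensated transmission time -/

theorem IsCredit.nonneg_and_le {ι Φ : Type*} {S : BLSServer ι} {X : FrameSchedule ι Φ}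
    {credit : ι → ℝ → ℝ} (hrun : IsBLSRun S X credit) {k : ι} (hk : S.Shaped k) {t : ℝ}
    (ht : 0 ≤ t) : 0 ≤ credit k t ∧ credit k t ≤ S.LM k := by
  have hc := hrun.isCredit k hk
  have hLM : 0 < S.LM k := (S.LR_nonneg k hk).trans_lt (S.LR_lt_LM k hk)
  have hi : 0 < S.Iidle k := mul_pos (S.BW_pos k hk) S.C_pos
  have ha : 0 < S.Isend k := by
    have := mul_lt_mul_of_pos_right (S.BW_lt_one k hk) S.C_pos
    simp only [BLSServer.Isend, BLSServer.Iidle]; linarith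
  have send : ∀ f ∈ X.sent, X.cls f = k → ∀ a b, 0 ≤ a → a ≤ b → X.start f ≤ a →
      b ≤ X.start f + X.size f / S.C → (0 ≤ credit k a ∧ credit k a ≤ S.LM k) →
      0 ≤ credit k b ∧ credit k b ≤ S.LM k := by
    intro f hf hfk a b h0 hab h1 h2 hP
    rw [hc.sending a b h0 hab fun τ hτ =>
      ⟨f, hfk, hf, h1.trans hτ.1, hτ.2.trans_le h2⟩]
    exact ⟨le_min hLM.le (add_nonneg hP.1 (mul_nonneg ha.le (sub_nonneg.2 hab))),
      min_le_left _ _⟩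
  have idle : ∀ a b, 0 ≤ a → a ≤ b → (∀ τ ∈ Ico a b, ¬ X.Transmitting S.C k τ) →
      credit k a ≤ S.LM k → 0 ≤ credit k b ∧ credit k b ≤ S.LM k := by
    intro a b h0 hab h hP
    rw [hc.idle a b h0 hab h]
    have := mul_nonneg hi.le (sub_nonneg.2 hab)
    exact ⟨le_max_left _ _, max_le hLM.le (by linarith)⟩
  refine hrun.transmission_induction k 0
    (fun t => 0 ≤ credit k t ∧ credit k t ≤ S.LM k) ?_ ?_ t ht
  · intro t ht h
    exact idle 0 t le_rfl ht h (hc.zero.le.trans hLM.le)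
  · intro t f hf hfk p h0 hpt hfp hpe _ hafter hP
    rcases le_total t (X.start f + X.size f / S.C) with hte | het
    · exact send f hf hfk p t h0 hpt hfp hte hP
    · exact idle _ t (h0.trans hpe) het hafter
        (send f hf hfk p _ h0 hpe hfp le_rfl hP).2

/-- While `MC k` is backlogged, the transmission time `W` of class `k`, compensated by the idle
time weighted by `r = Δsend / Δidle`, exceeds the time needed to gain the credit of the class only
if its priority is low, and then by at most the transmission time of one frame. -/
theorem IsBLSRun.compensated_output_le {ι Φ : Type*} {S : BLSServer ι} {X : FrameSchedule ι Φ}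
    {credit : ι → ℝ → ℝ} (hrun : IsBLSRun S X credit) {k : ι} (hk : S.Shaped k) {s T : ℝ}
    (hs : 0 ≤ s) (hMC : ∀ τ ∈ Ioc s T, MCBacklogged S X credit k τ) {a i m D r : ℝ}
    (ha : a = S.Isend k) (hi : i = S.Iidle k) (ha0 : 0 < a) (hi0 : 0 < i)
    (hm : m = S.MFS k / S.C) (hD : D = S.LM k - S.LR k) (hr : r = i / a + m * i / D)
    {V : ℝ → ℝ} (hV : ∀ t, V t = (1 + r) * (X.output S.C k t / S.C) - r * t)
    {t : ℝ} (hst : s ≤ t) (htT : t ≤ T) :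
    V t - V s ≤ S.LM k / a + m ∧
      (¬ IsLow S k (credit k) t → V t - V s ≤ credit k t / a) := by
  have hC := S.C_pos
  have hc := hrun.isCredit k hk
  have hbd : ∀ t, 0 ≤ t → 0 ≤ credit k t ∧ credit k t ≤ S.LM k := fun t ht =>
    IsCredit.nonneg_and_le hrun hk ht
  have hLR : S.LR k < S.LM k := S.LR_lt_LM k hk
  have hLM : 0 < S.LM k := (S.LR_nonneg k hk).trans_lt hLR
  have hD0 : 0 < D := by linarith
  have hm0 : 0 < m := hm ▸ div_pos (S.MFS_pos k) hC
  have hLMa : 0 < S.LM k / a := div_pos hLM ha0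
  have hria : i / a ≤ r := by
    have : 0 ≤ m * i / D := by positivity
    linarith
  have hr0 : 0 < r := (div_pos hi0 ha0).trans_le hria
  have Vsend : ∀ f ∈ X.sent, X.cls f = k → ∀ p q, p ≤ q → X.start f ≤ p →
      q ≤ X.start f + X.size f / S.C → V q = V p + (q - p) := by
    rintro f hf rfl p q hpq h1 h2
    rw [hV, hV, hrun.output_of_sending hf hpq h1 h2]
    field_simp
    ring
  have Vidle : ∀ p q, p ≤ q → (∀ τ ∈ Ico p q, ¬ X.Transmitting S.C k τ) →
      V q = V p - r * (q - p) := by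
    intro p q hpq h
    rw [hV, hV, hrun.output_eq_of_idle hpq h]
    ring
  have low_of_eq : ∀ t, 0 ≤ t → credit k t = S.LM k → IsLow S k (credit k) t := by
    intro t ht h
    refine ⟨t, ht, le_rfl, h, fun v hv => ?_⟩
    rw [le_antisymm hv.2 hv.1, h]
    exact hLR
  refine hrun.transmission_induction k s (fun t => t ≤ T → V t - V s ≤ S.LM k / a + m ∧
      (¬ IsLow S k (credit k) t → V t - V s ≤ credit k t / a)) ?_ ?_ t hst htT
  · intro t hst h _
    have h1 := Vidle s t hst h
    have h2 : 0 ≤ r * (t - s) := mul_nonneg hr0.le (sub_nonneg.2 hst)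
    have h3 : 0 ≤ credit k t / a := div_nonneg (hbd t (hs.trans hst)).1 ha0.le
    exact ⟨by linarith, fun _ => by linarith⟩
  · intro t f hf hfk p hsp hpt hfp hpe hp hafter hP htT
    set e := X.start f + X.size f / S.C with he
    have hp0 : 0 ≤ p := hs.trans hsp
    have hem : e - p ≤ m := by
      have : X.size f / S.C ≤ m := by
        rw [hm, ← hfk]
        exact div_le_div_of_nonneg_right (hrun.size_le f) hC.le
      linarith
    have hVp : V p - V s ≤ credit k p / a := by
      -- Backlog is not assumed at `s` itself, but there the left side is zero; a later start occurs
      -- at high priority.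
      rcases hp with rfl | ⟨hlt, rfl⟩
      · rw [sub_self]
        exact div_nonneg (hbd p hp0).1 ha0.le
      · refine (hP (hpt.trans htT)).2 ?_
        subst hfk
        exact hrun.not_isLow_start hf (hMC _ ⟨hlt, hpt.trans htT⟩)
    have hpa : credit k p / a ≤ S.LM k / a := div_le_div_of_nonneg_right (hbd p hp0).2 ha0.le
    have send : ∀ q, p ≤ q → q ≤ e → V q - V s ≤ S.LM k / a + m ∧
        (credit k q = S.LM k ∨ V q - V s ≤ credit k q / a) := by
      intro q hpq hqe
      have h1 := Vsend f hf hfk p q hpq hfp hqe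
      refine ⟨by linarith, ?_⟩
      have h2 := hc.sending p q hp0 hpq fun τ hτ =>
        ⟨f, hfk, hf, hfp.trans hτ.1, hτ.2.trans_le hqe⟩
      rcases min_choice (S.LM k) (credit k p + S.Isend k * (q - p)) with h | h
      · exact Or.inl (h2.trans h)
      · right
        rw [h2, h, ← ha, add_div, mul_div_cancel_left₀ _ ha0.ne']
        linarith
    rcases le_total t e with hte | het
    · obtain ⟨h1, h2⟩ := send t hpt hte
      refine ⟨h1, fun hlow => h2.resolve_left fun h => hlow (low_of_eq t (hp0.trans hpt) h)⟩
    · obtain ⟨h1, h2⟩ := send e hpe le_rfl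
      have he0 : 0 ≤ e := hp0.trans hpe
      have h3 := Vidle e t het hafter
      have h4 : 0 ≤ r * (t - e) := mul_nonneg hr0.le (sub_nonneg.2 het)
      have hidle : ∀ v, e ≤ v → v ≤ t → credit k v = max 0 (credit k e - i * (v - e)) := by
        intro v hev hvt
        rw [hi]
        exact hc.idle e v he0 hev fun τ hτ => hafter τ ⟨hτ.1, hτ.2.trans_le hvt⟩
      have h5 : credit k e / a - i / a * (t - e) ≤ credit k t / a := by
        have : (credit k e - i * (t - e)) / a ≤ credit k t / a :=
          div_le_div_of_nonneg_right (hidle t het le_rfl ▸ le_max_right _ _) ha0.le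
        refine le_trans (le_of_eq ?_) this
        ring
      refine ⟨by linarith, fun hlow => ?_⟩
      rcases h2 with h2 | h2
      -- Saturated at `e` but no longer low at `t`: the credit has come down to `LR` in between,
      -- which takes at least `D / i`.
      · have hv : ∃ v ∈ Icc e t, credit k v ≤ S.LR k := by
          by_contra! hcon
          exact hlow ⟨e, he0, het, h2, hcon⟩
        obtain ⟨v, hv, hvR⟩ := hv
        rw [hidle v hv.1 hv.2, h2] at hvR
        have h6 : D ≤ i * (t - e) := by
          have := (le_max_right _ _).trans hvR
          have := mul_le_mul_of_nonneg_left hv.2 hi0.le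
          linarith
        -- The extra rate `m * i / D` in `r` has cancelled the one-frame overshoot.
        have h7 : m ≤ m * i / D * (t - e) := by
          have : m * D ≤ m * (i * (t - e)) := mul_le_mul_of_nonneg_left h6 hm0.le
          rw [div_mul_eq_mul_div, le_div_iff₀ hD0]
          linarith
        rw [h2] at h5
        have h8 : r * (t - e) = i / a * (t - e) + m * i / D * (t - e) := by rw [hr]; ring
        linarith
      · have := mul_le_mul_of_nonneg_right hria (sub_nonneg.2 het)
        linarith

/-! ### Output bounds and service curves -/

theorem IsBLSRun.output_sub_le_of_mcBacklogged {ι Φ : Type*} {S : BLSServer ι}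
    {X : FrameSchedule ι Φ} {credit : ι → ℝ → ℝ} (hrun : IsBLSRun S X credit) {k : ι}
    (hk : S.Shaped k) :
    BoundsOutputDuring (MCBacklogged S X credit k) (X.output S.C k)
      (fun t => S.deltaSend k / S.deltaInter k * S.C * t +
        S.bMax k * (S.deltaIdle k / S.deltaInter k)) := by
  intro s t hs hst hMC
  have hC := S.C_pos
  have hi : 0 < S.Iidle k := mul_pos (S.BW_pos k hk) hC
  have ha : 0 < S.Isend k := by
    have := mul_lt_mul_of_pos_right (S.BW_lt_one k hk) hC
    simp only [BLSServer.Isend, BLSServer.Iidle]; linarith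
  have hD : 0 < S.LM k - S.LR k := sub_pos.2 (S.LR_lt_LM k hk)
  have hm := S.MFS_pos k
  have hΔi : 0 < S.deltaIdle k := div_pos hD hi
  have hΔs : 0 < S.deltaSend k := add_pos (div_pos hm hC) (div_pos hD ha)
  have hΔ : 0 < S.deltaInter k := add_pos hΔs hΔi
  have key := (hrun.compensated_output_le hk hs hMC rfl rfl ha hi rfl rfl
    (r := S.deltaSend k / S.deltaIdle k)
    (by simp only [BLSServer.deltaSend, BLSServer.deltaIdle]; field_simp; ring)
    (fun _ => rfl) hst le_rfl).1
  have hb : S.bMax k = S.C * (S.LM k / S.Isend k + S.MFS k / S.C) := by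
    rw [BLSServer.bMax]; field_simp
  have h1 : (1 + S.deltaSend k / S.deltaIdle k) = S.deltaInter k / S.deltaIdle k := by
    rw [BLSServer.deltaInter]; field_simp; ring
  -- Multiplying by `C / (1 + r)`, with `1 + r = Δinter / Δidle`, turns `V` back into output.
  have h2 := mul_le_mul_of_nonneg_left key
    (mul_nonneg hC.le (div_pos hΔi hΔ).le)
  rw [h1] at h2
  rw [hb]
  refine le_of_sub_nonneg (le_of_le_of_eq (sub_nonneg.2 h2) ?_)
  field_simp
  ring

theorem BoundsOutputDuring.isMaxServiceCurveDuring {P : ℝ → Prop} {R Rout γ : ℝ → ℝ}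
    (h : BoundsOutputDuring P Rout γ) (hle : ∀ t, Rout t ≤ R t) :
    IsMaxServiceCurveDuring P R Rout γ := fun s t hs hst hP => by
  linarith [h s t hs hst hP, hle s]

theorem theorem5 {ι Φ : Type*} (S : BLSServer ι) (X : FrameSchedule ι Φ) (credit : ι → ℝ → ℝ)
    (hrun : IsBLSRun S X credit) (k : ι) (hk : S.Shaped k) :
    (IsMaxServiceCurveDuring (fun τ => ¬ MCBacklogged S X credit k τ)
        (X.input k) (X.output S.C k) (fun t => S.C * t) ∧
      BoundsOutputDuring (fun τ => ¬ MCBacklogged S X credit k τ)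
        (X.output S.C k) (fun t => S.C * t)) ∧
    (IsMaxServiceCurveDuring (MCBacklogged S X credit k) (X.input k) (X.output S.C k)
        (fun t => S.deltaSend k / S.deltaInter k * S.C * t +
          S.bMax k * (S.deltaIdle k / S.deltaInter k)) ∧
      BoundsOutputDuring (MCBacklogged S X credit k) (X.output S.C k)
        (fun t => S.deltaSend k / S.deltaInter k * S.C * t +
          S.bMax k * (S.deltaIdle k / S.deltaInter k))) := by
  have h1 : BoundsOutputDuring (fun τ => ¬ MCBacklogged S X credit k τ)
      (X.output S.C k) (fun t => S.C * t) := fun s t _ hst _ => hrun.output_sub_le k hst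
  have h2 := hrun.output_sub_le_of_mcBacklogged hk
  exact ⟨⟨h1.isMaxServiceCurveDuring (hrun.output_le_input k), h1⟩,
    ⟨h2.isMaxServiceCurveDuring (hrun.output_le_input k), h2⟩⟩
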